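/- Time is discrete. Consider a set of $n$ sporadic tasks $\tau_1,\dots,\tau_n$ scheduled on one processor by preemptive fixed-priority scheduling, where $\tau_i$ has higher priority than $\tau_j$ if $i<j$. Task $\tau_i$ has a minimum inter-arrival time $T_i$, a relative deadline $D_i$ with $0<D_i\le T_i$, and an execution-time distribution $\mathcal C_i$ on the non-negative integers with finitely many values. It releases jobs $\tau_{i,1},\tau_{i,2},\dots$ at integer times $r_{i,1},r_{i,2},\dots$ with $r_{i,x+1}\ge r_{i,x}+T_i$; a choice of all these times is a release time pattern $\xi$. The execution times $\mathcal C_{i,x}$ of the jobs $\tau_{i,x}$ are independent, and $\mathcal C_{i,x}$ is distributed as $\mathcal C_i$. A job that is not finished at its absolute deadline $r_{i,x}+D_i$ is aborted at that time, and its response time $\mathcal R^{\xi}_{i,x}$ is then $\infty$. The worst-case deadline failure probability of $\tau_i$ is $$\mathrm{WCDFP}_i=\sup_{\xi}\,\sup_{x\ge 1}\,\mathbb P(\mathcal R^{\xi}_{i,x}>D_i).$$ Fix a task $\tau_k$ and define the following. - $\displaystyle \rho=\inf_{0<t\le D_k}\mathbb P\Big(\mathcal C_{k,1}+\sum_{j<k}\sum_{x=1}^{\lceil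 t/T_j\rceil}\mathcal C_{j,x}>t\Big)$. - $\mathrm{BW}^{\xi^*}\in\{0,1,2,\dots\}\cup\{\infty\}$ is the length of the busy period starting at time $0$ when $\tau_k$ releases one job at time $0$, every $\tau_j$ with $j<k$ releases its jobs at times $0,T_j,2T_j,\dots$, and no job is aborted. That is, it is the first time $t\ge 0$ at which the total execution time of the jobs released at time $0$ or in $[0,t)$ is at most $t$ (and $\infty$ if there is no such $t$). - $n_k=1$ and $n_i=\big\lceil \big(\sum_{l=i}^{k-1}D_l\big)/T_i\big\rceil$ for $i<k$. The candidates are the pairs $(i,j)$ with $1\le i\le k$ and $1\le j\le n_i$. - $B_1$ is the set of candidates $(i,j)$ with $\mathbb P(\mathrm{BW}^{\xi^*}\ge (j-1)T_i+D_k)<\rho$, and $B_2$ is the set of candidates with $\mathbb P(\mathrm{BW}^{\xi^*}\ge (j-1)T_i+D_k)\ge\rho$. Let $m=|B_2|$. Then $$\mathrm{WCDFP}_k\;\le\;\sum_{(i,j)\in B_1}\mathbb P\big(\mathrm{BW}^{\xi^*}\ge (j-1)T_i+D_k\big)\;+\;1-(1-\rho)^m .$$ -/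

import Mathlib

/-- A constrained-deadline sporadic task set with `n` tasks on one processor, in discrete time.
Tasks are indexed in priority order: `i < j` means that task `i` has higher priority than task
`j`. Task `i` has relative deadline `D i`, minimum inter-arrival time `T i` and a probabilistic
worst-case execution time `pwcet i`, a distribution with finitely many values. -/
structure TaskSet (n : ℕ) where
  T : Fin n → ℕ
  D : Fin n → ℕ
  pwcet : Fin n → PMF ℕ
  D_pos : ∀ i, 0 < D i
  D_le_T : ∀ i, D i ≤ T i
  pwcet_finite : ∀ i, (pwcet i).support.Finite

namespace TaskSet

variable {n : ℕ}

/-- A release time pattern: `release i x` is the release time of the job of task `i` with index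
`x` (indices start at `0`); consecutive releases of task `i` are at least `T i` apart. -/
structure ReleasePattern (τ : TaskSet n) where
  release : Fin n → ℕ → ℕ
  sep : ∀ i x, release i x + τ.T i ≤ release i (x + 1)

/-- An execution time pattern: `c (i, x)` is the execution time of the job of task `i` with
index `x`. -/
abbrev ExecPattern (n : ℕ) : Type := Fin n × ℕ → ℕ

/-- The probability on execution time patterns: the execution times of all jobs are independent,
and every job of task `i` has the distribution `pwcet i`. -/
noncomputable def prob (τ : TaskSet n) : MeasureTheory.Measure (ExecPattern n) :=
  MeasureTheory.Measure.infinitePi fun p : Fin n × ℕ => (τ.pwcet p.1).toMeasure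

/-! ### Preemptive fixed-priority scheduling, jobs being aborted at their deadlines -/

/-- Given the amounts of service `s` received before time `t`, job `x` of task `i` is ready in
the time slot `[t, t + 1)`: it has been released, its deadline has not been reached (at the
deadline it is aborted), and it is not finished. -/
def Ready (τ : TaskSet n) (ξ : τ.ReleasePattern) (c : ExecPattern n) (s : Fin n → ℕ → ℕ)
    (t : ℕ) (i : Fin n) (x : ℕ) : Prop :=
  ξ.release i x ≤ t ∧ t < ξ.release i x + τ.D i ∧ s i x < c (i, x)

/-- The processor executes job `x` of task `i` in the slot `[t, t + 1)`: the job is ready and no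
job of a higher-priority task is ready. Since `D i ≤ T i`, at most one job of each task is ready
at any time, so at most one job is executed in a slot. -/
def Executes (τ : TaskSet n) (ξ : τ.ReleasePattern) (c : ExecPattern n) (s : Fin n → ℕ → ℕ)
    (t : ℕ) (i : Fin n) (x : ℕ) : Prop :=
  τ.Ready ξ c s t i x ∧ ∀ j < i, ∀ y, ¬ τ.Ready ξ c s t j y

open scoped Classical in
/-- `service ξ c t i x` is the amount of time for which job `x` of task `i` has been executed
in `[0, t)`. -/
noncomputable def service (τ : TaskSet n) (ξ : τ.ReleasePattern) (c : ExecPattern n) :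
    ℕ → Fin n → ℕ → ℕ
  | 0 => fun _ _ => 0
  | t + 1 => fun i x => service τ ξ c t i x +
      if τ.Executes ξ c (service τ ξ c t) t i x then 1 else 0

/-- The response time: the least `d` such that the job is finished at time `d` after its release,
and `⊤` if the job never finishes (because it is aborted). -/
noncomputable def responseTime (τ : TaskSet n) (ξ : τ.ReleasePattern) (c : ExecPattern n)
    (i : Fin n) (x : ℕ) : ℕ∞ :=
  ⨅ (d : ℕ) (_ : c (i, x) ≤ τ.service ξ c (ξ.release i x + d) i x), (d : ℕ∞)

/-- The deadline failure probability of job `x` of task `i` under the release pattern `ξ`. -/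
noncomputable def dfp (τ : TaskSet n) (ξ : τ.ReleasePattern) (i : Fin n) (x : ℕ) : ℝ :=
  τ.prob.real {c | (τ.D i : ℕ∞) < τ.responseTime ξ c i x}

/-- The worst-case deadline failure probability of task `i`. -/
noncomputable def wcdfp (τ : TaskSet n) (i : Fin n) : ℝ :=
  ⨆ ξ : τ.ReleasePattern, ⨆ x : ℕ, τ.dfp ξ i x

/-! ### The quantities of the bound -/

/-- `ρ = inf_{0 < t ≤ D k} P(C_{k,1} + ∑_{j < k} ∑_{x = 1}^{⌈t / T j⌉} C_{j,x} > t)`, with job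
indices shifted to start at `0`; `t` runs over discrete time and `⌈/⌉` is the rounded-up
quotient. -/
noncomputable def rho (τ : TaskSet n) (k : Fin n) : ℝ :=
  ⨅ t : Finset.Icc 1 (τ.D k), τ.prob.real
    {c | (t : ℕ) < c (k, 0) + ∑ j ∈ Finset.Iio k, ∑ x ∈ Finset.range ((t : ℕ) ⌈/⌉ τ.T j), c (j, x)}

/-- The total execution time of one job of task `k` released at time `0` and of the jobs of
higher-priority tasks that are released at time `0` or in `[0, t)`, when every task `j < k`
releases its jobs at times `0, T j, 2 * T j, …`. For `t > 0` there are `⌈t / T j⌉` such jobs of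
task `j`; for `t = 0` there is one. -/
def syncWorkload (τ : TaskSet n) (k : Fin n) (c : ExecPattern n) (t : ℕ) : ℕ :=
  c (k, 0) + ∑ j ∈ Finset.Iio k, ∑ x ∈ Finset.range (max 1 (t ⌈/⌉ τ.T j)), c (j, x)

/-- The length of the busy period that starts at time `0` in the synchronous periodic release
pattern, when no work is discarded: the first time `t` at which all work released so far (not
counting jobs that are released at `t` itself, unless `t = 0`) is finished. It is `⊤` if the
busy period never ends. -/
noncomputable def busyLength (τ : TaskSet n) (k : Fin n) (c : ExecPattern n) : ℕ∞ :=
  ⨅ (t : ℕ) (_ : τ.syncWorkload k c t ≤ t), (t : ℕ∞)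

/-- The bound `P(BW ≥ (j - 1) * T i + D k)` for the candidate `(i, j)`, where `j ≥ 1`. -/
noncomputable def busyBound (τ : TaskSet n) (k : Fin n) (p : Fin n × ℕ) : ℝ :=
  τ.prob.real {c | (((p.2 - 1) * τ.T p.1 + τ.D k : ℕ) : ℕ∞) ≤ τ.busyLength k c}

/-- The maximal number of start points of the busy period that are release times of task `i`:
`⌈(∑_{i ≤ j < k} D j) / T i⌉` for `i < k`, and `1` for `i = k`. -/
def numStarts (τ : TaskSet n) (k i : Fin n) : ℕ :=
  if i = k then 1 else (∑ j ∈ Finset.Ico i k, τ.D j) ⌈/⌉ τ.T i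

/-- The candidates: all pairs `(i, j)` with `i ≤ k` and `1 ≤ j ≤ numStarts k i`. The pair `(i, j)`
stands for the busy period starting at the `j`-th latest release of task `i`. -/
def candidates (τ : TaskSet n) (k : Fin n) : Finset (Fin n × ℕ) :=
  (Finset.Iic k).biUnion fun i => (Finset.Icc 1 (τ.numStarts k i)).image fun j => (i, j)

open scoped Classical in
/-- Candidates for which the busy-period bound is smaller than `ρ`. -/
noncomputable def B1 (τ : TaskSet n) (k : Fin n) : Finset (Fin n × ℕ) :=
  {p ∈ τ.candidates k | τ.busyBound k p < τ.rho k}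

open scoped Classical in
/-- Candidates for which `ρ` is at most the busy-period bound. -/
noncomputable def B2 (τ : TaskSet n) (k : Fin n) : Finset (Fin n × ℕ) :=
  {p ∈ τ.candidates k | τ.rho k ≤ τ.busyBound k p}

end TaskSet

/-! Fix a release pattern and a job of task `k` that misses its deadline. Go back from its release
through the tasks `k - 1, …, 0`, moving to the release of a carry-in job whenever the task has one.
This gives a start `a` from which the processor works, up to the deadline, only on that job and on
higher-priority jobs released since `a` (`BusyFrom.step`). The move for task `i` is shorter than `D
i`, so `a` is the release of one of the candidates.

For a given start, failure forces `overload`: every window from `a` up to the deadline receives more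
work than its length. By relabelling jobs, the probability of this depends only on the length `L`
(`prob_real_overload`), and it is at most both `ρ` and the busy-period bound.

The union bound handles `B1`. Overload events are increasing in the independent execution times, so
by Harris' inequality their complements are positively correlated: with probability at least `(1 -
ρ) ^ m` none of those in `B2` occurs. -/

open MeasureTheory

/-! ### Product measures: Harris' inequality and relabelling -/

section Association

variable {ι : Type*}

/-- A set of `ℕ`-valued families that depends on finitely many coordinates is measurable. -/
theorem measurableSet_of_dependsOn {J : Finset ι} {A : Set (ι → ℕ)}
    (hA : DependsOn (· ∈ A) (J : Set ι)) : MeasurableSet A := by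
  have h : A = (fun (c : ι → ℕ) (i : J) => c i) ⁻¹' ((fun (c : ι → ℕ) (i : J) => c i) '' A) := by
    ext c
    refine ⟨fun hc => ⟨c, hc, rfl⟩, ?_⟩
    rintro ⟨d, hd, hdc⟩
    have := iff_of_eq <| hA (x := d) (y := c) fun i hi => congrFun hdc ⟨i, hi⟩
    exact this.mp hd
  rw [h]
  exact measurableSet_preimage (by fun_prop) (Set.to_countable _).measurableSet

theorem DependsOn.mem_inter {α : ι → Type*} {s : Set ι} {A B : Set (∀ i, α i)}
    (hA : DependsOn (· ∈ A) s) (hB : DependsOn (· ∈ B) s) : DependsOn (· ∈ A ∩ B) s :=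
  fun x y hxy => by
    have h1 := hA hxy
    have h2 := hB hxy
    simp_all

/-- Truncation of the coordinates in `J` at the value `M`. -/
def truncate (J : Finset ι) (M : ℕ) (c : ι → ℕ) (i : J) : Fin (M + 1) :=
  ⟨min (c i) M, Nat.lt_succ_of_le (min_le_right _ _)⟩

theorem measurable_truncate (J : Finset ι) (M : ℕ) : Measurable (truncate J M) := by
  refine measurable_pi_lambda _ fun i => ?_
  exact (measurable_from_top (f := fun v : ℕ =>
    (⟨min v M, Nat.lt_succ_of_le (min_le_right _ _)⟩ : Fin (M + 1)))).comp (measurable_pi_apply _)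

variable (ν : ι → PMF ℕ)

theorem infinitePi_truncate_eq (J : Finset ι) (M : ℕ) (a : J → Fin (M + 1)) :
    (Measure.infinitePi fun i => (ν i).toMeasure).real {c | truncate J M c = a} =
      ∏ i : J, (ν i).toMeasure.real {v | min v M = a i} := by
  classical
  have h : {c | truncate J M c = a} =
      (J : Set ι).pi fun i => {v | ∀ h : i ∈ J, min v M = a ⟨i, h⟩} := by
    ext c
    simp only [Set.mem_ofPred_eq, Set.mem_pi, funext_iff, Fin.ext_iff, truncate, Subtype.forall]
    exact ⟨fun h i hi _ => h i hi, fun h i hi => h i hi hi⟩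
  rw [h, measureReal_def, Measure.infinitePi_pi _ fun _ _ => .of_discrete, ENNReal.toReal_prod,
    ← Finset.prod_attach]
  exact Finset.prod_congr rfl fun i _ => by simp [measureReal_def]

theorem exists_forall_mem_support_le (hν : ∀ i, (ν i).support.Finite) (J : Finset ι) :
    ∃ M, ∀ i ∈ J, ∀ v ∈ (ν i).support, v ≤ M := by
  obtain ⟨M, hM⟩ := (J.finite_toSet.biUnion fun i _ => hν i).bddAbove
  exact ⟨M, fun i hi v hv => hM (Set.mem_biUnion hi hv)⟩

theorem ae_infinitePi_le {J : Finset ι} {M : ℕ} (hM : ∀ i ∈ J, ∀ v ∈ (ν i).support, v ≤ M) :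
    ∀ᵐ c ∂(Measure.infinitePi fun i => (ν i).toMeasure), ∀ i ∈ J, c i ≤ M := by
  rw [Filter.eventually_all_finset]
  intro i hi
  have h0 : ∀ᵐ v ∂(ν i).toMeasure, v ≤ M := by
    rw [ae_iff, PMF.toMeasure_apply_eq_zero_iff _ .of_discrete, Set.disjoint_left]
    exact fun v hv => by simpa using hM i hi v hv
  exact (measurePreserving_eval_infinitePi (fun i => (ν i).toMeasure) i).quasiMeasurePreserving.ae h0

/-- Extension by zero of a family of truncated values. -/
def extendZero [DecidableEq ι] {J : Finset ι} {M : ℕ} (a : J → Fin (M + 1)) (i : ι) : ℕ :=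
  if h : i ∈ J then a ⟨i, h⟩ else 0

theorem extendZero_mono [DecidableEq ι] {J : Finset ι} {M : ℕ} :
    Monotone (extendZero : (J → Fin (M + 1)) → ι → ℕ) := fun a b hab i => by
  unfold extendZero
  split_ifs with h
  · exact hab ⟨i, h⟩
  · rfl

/-- Truncation at `M` almost surely changes nothing on `J`, so probabilities become weighted sums
over the finite distributive lattice `J → Fin (M + 1)`, where `fkg` applies. -/
theorem infinitePi_real_eq_sum [DecidableEq ι] {J : Finset ι} {M : ℕ}
    (hM : ∀ i ∈ J, ∀ v ∈ (ν i).support, v ≤ M) {A : Set (ι → ℕ)}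
    (hA : DependsOn (· ∈ A) (J : Set ι)) :
    (Measure.infinitePi fun i => (ν i).toMeasure).real A =
      ∑ a : J → Fin (M + 1), (∏ i : J, (ν i).toMeasure.real {v | min v M = a i}) *
        A.indicator 1 (extendZero a) := by
  classical
  set P := Measure.infinitePi fun i => (ν i).toMeasure
  have h1 : P.real A = P.real (truncate J M ⁻¹' (extendZero ⁻¹' A)) := by
    refine measureReal_congr ?_
    filter_upwards [ae_infinitePi_le ν hM] with c hc
    refine hA fun i hi => ?_
    have hi' : i ∈ J := hi
    simp [extendZero, hi', truncate, hc i hi']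
  have h2 := map_measureReal_apply (μ := P) (measurable_truncate J M)
    (Set.toFinite (extendZero ⁻¹' A)).measurableSet
  rw [h1, ← h2, ← Set.coe_toFinset (extendZero ⁻¹' A), ← sum_measureReal_singleton,
    ← Finset.sum_subset (Finset.subset_univ (extendZero ⁻¹' A).toFinset)]
  · refine Finset.sum_congr rfl fun a ha => ?_
    rw [← infinitePi_truncate_eq, map_measureReal_apply (measurable_truncate J M) (.singleton _),
      Set.indicator_of_mem (by simpa using ha), Pi.one_apply, mul_one]
    rfl
  · intro a _ ha
    rw [Set.indicator_of_notMem (by simpa using ha), mul_zero]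

/-- **Harris inequality**: for independent `ℕ`-valued coordinates with finite supports, increasing
events that depend on finitely many coordinates are positively correlated. -/
theorem infinitePi_real_mul_le_inter (hν : ∀ i, (ν i).support.Finite) {J : Finset ι}
    {A B : Set (ι → ℕ)} (hA : IsUpperSet A) (hB : IsUpperSet B)
    (hAJ : DependsOn (· ∈ A) (J : Set ι)) (hBJ : DependsOn (· ∈ B) (J : Set ι)) :
    (Measure.infinitePi fun i => (ν i).toMeasure).real A *
        (Measure.infinitePi fun i => (ν i).toMeasure).real B ≤
      (Measure.infinitePi fun i => (ν i).toMeasure).real (A ∩ B) := by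
  classical
  obtain ⟨M, hM⟩ := exists_forall_mem_support_le ν hν J
  have hone := infinitePi_real_eq_sum ν hM (A := Set.univ) (fun _ _ _ => by simp)
  rw [probReal_univ] at hone
  simp only [Set.indicator_univ, Pi.one_apply, mul_one] at hone
  rw [infinitePi_real_eq_sum ν hM hAJ, infinitePi_real_eq_sum ν hM hBJ,
    infinitePi_real_eq_sum ν hM (hAJ.mem_inter hBJ)]
  have hpos : ∀ C : Set (ι → ℕ), 0 ≤ fun a : J → Fin (M + 1) =>
      C.indicator (1 : (ι → ℕ) → ℝ) (extendZero a) :=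
    fun C a => Set.indicator_nonneg (fun _ _ => zero_le_one) _
  have hmono : ∀ C : Set (ι → ℕ), IsUpperSet C → Monotone fun a : J → Fin (M + 1) =>
      C.indicator (1 : (ι → ℕ) → ℝ) (extendZero a) := by
    intro C hC a b hab
    by_cases ha : extendZero a ∈ C
    · simp [ha, hC (extendZero_mono hab) ha]
    · simpa [ha] using hpos C b
  have key := fkg _ _ (fun a : J → Fin (M + 1) => ∏ i : J, (ν i).toMeasure.real {v | min v M = a i})
    (fun a => Finset.prod_nonneg fun _ _ => measureReal_nonneg)
    (hpos A) (hpos B) (hmono A hA) (hmono B hB) ?_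
  · rw [← hone, one_mul] at key
    simpa only [Set.inter_indicator_one, Pi.mul_apply] using key
  -- The lattice condition holds with equality: each coordinate is a chain, so meet and join only
  -- permute `a i` and `b i`, and the weight is a product.
  · intro a b
    rw [← Finset.prod_mul_distrib, ← Finset.prod_mul_distrib]
    refine Finset.prod_le_prod (fun _ _ => by positivity) fun i _ => ?_
    rcases le_total (a i) (b i) with h | h
    · simp [h]
    · simp [h, mul_comm]

/-- Inclusion–exclusion turns Harris' inequality for two events into one for their complements;
unions of increasing events are increasing, so induction applies. -/
theorem prod_one_sub_le_infinitePi_real (hν : ∀ i, (ν i).support.Finite) {J : Finset ι}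
    {β : Type*} (s : Finset β) {A : β → Set (ι → ℕ)} (hA : ∀ b ∈ s, IsUpperSet (A b))
    (hAJ : ∀ b ∈ s, DependsOn (· ∈ A b) (J : Set ι)) :
    ∏ b ∈ s, (1 - (Measure.infinitePi fun i => (ν i).toMeasure).real (A b)) ≤
      1 - (Measure.infinitePi fun i => (ν i).toMeasure).real (⋃ b ∈ s, A b) := by
  classical
  induction s using Finset.induction_on with
  | empty => simp
  | insert b s hb ih =>
    simp only [Finset.forall_mem_insert] at hA hAJ
    have hU : IsUpperSet (⋃ b ∈ s, A b) := isUpperSet_iUnion₂ hA.2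
    have hUJ : DependsOn (· ∈ ⋃ b ∈ s, A b) (J : Set ι) := fun x y hxy => by
      simp only [Set.mem_iUnion, eq_iff_iff]
      exact exists_congr fun b => exists_congr fun hb => by simpa using hAJ.2 b hb hxy
    have h1 := infinitePi_real_mul_le_inter ν hν hA.1 hU hAJ.1 hUJ
    have h2 := measureReal_union_add_inter (μ := Measure.infinitePi fun i => (ν i).toMeasure)
      (s := A b) (t := ⋃ b ∈ s, A b)
      (measurableSet_of_dependsOn hUJ) (measure_ne_top _ _) (measure_ne_top _ _)
    have h3 := mul_le_mul_of_nonneg_left (ih hA.2 hAJ.2) (sub_nonneg.2 (measureReal_le_one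
      (μ := Measure.infinitePi fun i => (ν i).toMeasure) (s := A b)))
    rw [Finset.prod_insert hb, Finset.set_biUnion_insert]
    linarith

/-- The product of copies of the same distributions is invariant under injective relabelling of the
coordinates. -/
theorem measurePreserving_infinitePi_comp {f : ι → ι} (hf : Function.Injective f)
    (hνf : ∀ i, ν (f i) = ν i) :
    MeasurePreserving (fun (c : ι → ℕ) i => c (f i))
      (Measure.infinitePi fun i => (ν i).toMeasure)
      (Measure.infinitePi fun i => (ν i).toMeasure) := by
  classical
  have hm : Measurable fun (c : ι → ℕ) i => c (f i) := by fun_prop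
  refine ⟨hm, Measure.eq_infinitePi _ fun s t ht => ?_⟩
  rw [Measure.map_apply hm (.pi s.countable_toSet fun i _ => ht i)]
  -- The preimage of a cylinder over `s` is a cylinder over the image of `s`; quantifying over `j`
  -- with `f j = i` avoids an inverse of `f`.
  have h : (fun (c : ι → ℕ) i => c (f i)) ⁻¹' (s : Set ι).pi t =
      ((s.map ⟨f, hf⟩ : Finset ι) : Set ι).pi fun i => {v | ∀ j, f j = i → v ∈ t j} := by
    ext c
    simp only [Set.mem_preimage, Set.mem_pi, Finset.coe_map, Function.Embedding.coeFn_mk,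
      Set.forall_mem_image, Set.mem_ofPred_eq]
    exact forall₂_congr fun i hi =>
      ⟨fun h j hj => by rw [hf hj]; exact h, fun h => h i rfl⟩
  rw [h, Measure.infinitePi_pi _ fun _ _ => .of_discrete, Finset.prod_map]
  refine Finset.prod_congr rfl fun i _ => ?_
  simp only [Function.Embedding.coeFn_mk, hνf]
  congr 1
  ext v
  exact ⟨fun h => h i rfl, fun h j hj => by rw [hf hj]; exact h⟩

end Association

/-! ### Overload events and their two probability bounds -/

namespace TaskSet

variable {n : ℕ}

theorem T_pos (τ : TaskSet n) (i : Fin n) : 0 < τ.T i := (τ.D_pos i).trans_le (τ.D_le_T i)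

instance (τ : TaskSet n) : IsProbabilityMeasure τ.prob := by
  unfold prob; infer_instance

/-- When `f j` is the index of the first job of task `j` that is counted, these are the job of task
`k` under analysis and the jobs of higher-priority tasks that can be released in a window of length
`s`. -/
def windowJobs (τ : TaskSet n) (k : Fin n) (f : Fin n → ℕ) (s : ℕ) : Finset (Fin n × ℕ) :=
  insert (k, f k) ((Finset.Iio k).biUnion fun j =>
    (Finset.range (s ⌈/⌉ τ.T j)).image fun y => (j, f j + y))

theorem mem_windowJobs {τ : TaskSet n} {k : Fin n} {f : Fin n → ℕ} {s : ℕ} {p : Fin n × ℕ} :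
    p ∈ τ.windowJobs k f s ↔
      p = (k, f k) ∨ p.1 < k ∧ f p.1 ≤ p.2 ∧ p.2 - f p.1 < s ⌈/⌉ τ.T p.1 := by
  obtain ⟨i, x⟩ := p
  simp only [windowJobs, Finset.mem_insert, Finset.mem_biUnion, Finset.mem_Iio, Finset.mem_image,
    Finset.mem_range, Prod.mk.injEq]
  refine or_congr_right ⟨?_, fun ⟨h1, h2, h3⟩ => ⟨i, h1, x - f i, h3, rfl, by omega⟩⟩
  rintro ⟨j, hj, y, hy, rfl, rfl⟩
  exact ⟨hj, by omega, by simpa using hy⟩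

theorem sum_windowJobs (τ : TaskSet n) (k : Fin n) (f : Fin n → ℕ) (s : ℕ) (c : ExecPattern n) :
    ∑ p ∈ τ.windowJobs k f s, c p =
      c (k, f k) + ∑ j ∈ Finset.Iio k, ∑ y ∈ Finset.range (s ⌈/⌉ τ.T j), c (j, f j + y) := by
  rw [windowJobs, Finset.sum_insert, Finset.sum_biUnion]
  · congr 1
    refine Finset.sum_congr rfl fun j _ => Finset.sum_image fun y _ z _ h => ?_
    simpa using h
  · intro i _ j _ hij
    simp only [Function.onFun, Finset.disjoint_left, Finset.mem_image]
    rintro p ⟨y, _, rfl⟩ ⟨z, _, h⟩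
    exact hij (congrArg Prod.fst h).symm
  · simp only [Finset.mem_biUnion, Finset.mem_Iio, Finset.mem_image, not_exists, not_and]
    intro j hj y _ h
    exact hj.ne (congrArg Prod.fst h)

/-- The window jobs keep the processor busy for longer than `L`. -/
def overload (τ : TaskSet n) (k : Fin n) (f : Fin n → ℕ) (L : ℕ) : Set (ExecPattern n) :=
  {c | ∀ s ∈ Finset.Icc 1 L, s < ∑ p ∈ τ.windowJobs k f s, c p}

theorem isUpperSet_overload (τ : TaskSet n) (k : Fin n) (f : Fin n → ℕ) (L : ℕ) :
    IsUpperSet (τ.overload k f L) := fun _ _ hcd hc s hs =>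
  (hc s hs).trans_le (Finset.sum_le_sum fun p _ => hcd p)

theorem dependsOn_overload (τ : TaskSet n) (k : Fin n) (f : Fin n → ℕ) (L : ℕ) :
    DependsOn (· ∈ τ.overload k f L)
      ((Finset.Icc 1 L).biUnion (τ.windowJobs k f) : Finset (Fin n × ℕ)) := fun c d hcd => by
  refine propext (forall₂_congr fun s hs => ?_)
  rw [Finset.sum_congr rfl fun p hp => hcd p (Finset.mem_biUnion.2 ⟨s, hs, hp⟩)]

/-- The shift `(i, x) ↦ (i, f i + x)` is injective and preserves the task, hence the distribution of
each job. -/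
theorem prob_real_overload (τ : TaskSet n) (k : Fin n) (f : Fin n → ℕ) (L : ℕ) :
    τ.prob.real (τ.overload k f L) = τ.prob.real (τ.overload k 0 L) := by
  have hmp := measurePreserving_infinitePi_comp (fun p : Fin n × ℕ => τ.pwcet p.1)
    (f := fun p => (p.1, f p.1 + p.2)) (fun p q h => by
      obtain ⟨i, x⟩ := p
      obtain ⟨j, y⟩ := q
      obtain ⟨rfl, h⟩ := Prod.mk.inj h
      simpa using h) fun _ => rfl
  have := hmp.measureReal_preimage
    (measurableSet_of_dependsOn (τ.dependsOn_overload k 0 L)).nullMeasurableSet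
  rw [prob, ← this]
  congr 1
  ext c
  simp [overload, sum_windowJobs]

theorem overload_zero_subset_busy (τ : TaskSet n) (k : Fin n) {t L : ℕ} (hL : 0 < L) (ht : t ≤ L) :
    τ.overload k 0 L ⊆ {c | (t : ℕ∞) ≤ τ.busyLength k c} := by
  intro c hc
  rw [Set.mem_ofPred_eq, busyLength]
  refine le_iInf₂ fun u hu => ?_
  by_contra! hut
  have hut : u < t := by exact_mod_cast hut
  -- The case `u = 0` uses the window of length `1`: `syncWorkload` at `0` already counts one job
  -- per task.
  have h1 := hc (max 1 u) (by simp only [Finset.mem_Icc]; omega)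
  refine (h1.trans_le ?_).not_ge (hu.trans (le_max_right _ _))
  rw [sum_windowJobs, syncWorkload]
  simp only [Pi.zero_apply, zero_add]
  gcongr with j hj
  rw [ceilDiv_le_iff_le_mul (τ.T_pos j), max_le_iff]
  constructor
  · exact Nat.mul_pos (τ.T_pos j) (by omega)
  · exact ((ceilDiv_le_iff_le_mul (τ.T_pos j)).1 le_rfl).trans
      (Nat.mul_le_mul_left _ (le_max_right _ _))

theorem prob_overload_le_busyBound (τ : TaskSet n) (k : Fin n) (f : Fin n → ℕ) {L : ℕ}
    {p : Fin n × ℕ} (hL : (p.2 - 1) * τ.T p.1 + τ.D k ≤ L) :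
    τ.prob.real (τ.overload k f L) ≤ τ.busyBound k p := by
  rw [prob_real_overload]
  exact measureReal_mono
    (τ.overload_zero_subset_busy k ((τ.D_pos k).trans_le (by omega)) hL)

theorem rho_bddBelow (τ : TaskSet n) (k : Fin n) :
    BddBelow (Set.range fun t : Finset.Icc 1 (τ.D k) => τ.prob.real
      {c | (t : ℕ) < c (k, 0) + ∑ j ∈ Finset.Iio k,
        ∑ x ∈ Finset.range ((t : ℕ) ⌈/⌉ τ.T j), c (j, x)}) :=
  ⟨0, by rintro _ ⟨t, rfl⟩; exact measureReal_nonneg⟩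

theorem rho_nonneg (τ : TaskSet n) (k : Fin n) : 0 ≤ τ.rho k :=
  Real.iInf_nonneg fun _ => measureReal_nonneg

theorem rho_le_one (τ : TaskSet n) (k : Fin n) : τ.rho k ≤ 1 :=
  ciInf_le_of_le (τ.rho_bddBelow k) ⟨1, Finset.mem_Icc.2 ⟨le_rfl, τ.D_pos k⟩⟩ measureReal_le_one

/-- Overload constrains all lengths up to `L ≥ D k`, so it lies inside each event of the infimum. -/
theorem prob_overload_le_rho (τ : TaskSet n) (k : Fin n) (f : Fin n → ℕ) {L : ℕ}
    (hL : τ.D k ≤ L) : τ.prob.real (τ.overload k f L) ≤ τ.rho k := by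
  have : Nonempty (Finset.Icc 1 (τ.D k)) := ⟨1, Finset.mem_Icc.2 ⟨le_rfl, τ.D_pos k⟩⟩
  rw [prob_real_overload]
  refine le_ciInf fun ⟨t, ht⟩ => measureReal_mono fun c hc => ?_
  have ht' := Finset.mem_Icc.1 ht
  simpa [sum_windowJobs] using hc t (Finset.mem_Icc.2 ⟨ht'.1, ht'.2.trans hL⟩)

/-! ### Release times and job indices -/

namespace ReleasePattern

variable {τ : TaskSet n}

theorem release_add_mul_le (ξ : τ.ReleasePattern) (i : Fin n) (x d : ℕ) :
    ξ.release i x + d * τ.T i ≤ ξ.release i (x + d) := by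
  induction d with
  | zero => simp
  | succ d ih => have := ξ.sep i (x + d); rw [← add_assoc]; linarith

theorem release_add_sub_mul_le (ξ : τ.ReleasePattern) (i : Fin n) {x y : ℕ} (h : x ≤ y) :
    ξ.release i x + (y - x) * τ.T i ≤ ξ.release i y := by
  obtain ⟨d, rfl⟩ := Nat.exists_eq_add_of_le h
  simpa using ξ.release_add_mul_le i x d

theorem release_strictMono (ξ : τ.ReleasePattern) (i : Fin n) : StrictMono (ξ.release i) :=
  strictMono_nat_of_lt_succ fun x => by have := ξ.sep i x; have := τ.T_pos i; omega

/-- The number of releases of task `i` before time `a`, which is the index of the first job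
released at `a` or later. -/
noncomputable def firstIndex (ξ : τ.ReleasePattern) (i : Fin n) (a : ℕ) : ℕ :=
  sInf {x | a ≤ ξ.release i x}

theorem le_release_firstIndex (ξ : τ.ReleasePattern) (i : Fin n) (a : ℕ) :
    a ≤ ξ.release i (ξ.firstIndex i a) :=
  Nat.sInf_mem (s := {x | a ≤ ξ.release i x}) ⟨a, (ξ.release_strictMono i).le_apply⟩

theorem firstIndex_le_iff (ξ : τ.ReleasePattern) {i : Fin n} {a x : ℕ} :
    ξ.firstIndex i a ≤ x ↔ a ≤ ξ.release i x :=
  ⟨fun h => (ξ.le_release_firstIndex i a).trans ((ξ.release_strictMono i).monotone h),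
    fun h => Nat.sInf_le h⟩

end ReleasePattern

/-! ### The schedule and the start of the busy window -/

section Schedule

variable (τ : TaskSet n) (ξ : τ.ReleasePattern) (c : ExecPattern n)

open scoped Classical in
theorem service_succ (t : ℕ) (i : Fin n) (x : ℕ) : τ.service ξ c (t + 1) i x =
    τ.service ξ c t i x + if τ.Executes ξ c (τ.service ξ c t) t i x then 1 else 0 := rfl

theorem service_mono (i : Fin n) (x : ℕ) : Monotone fun t => τ.service ξ c t i x :=
  monotone_nat_of_le_succ fun t => by rw [service_succ]; exact Nat.le_add_right _ _

theorem service_le (t : ℕ) (i : Fin n) (x : ℕ) : τ.service ξ c t i x ≤ c (i, x) := by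
  induction t with
  | zero => exact Nat.zero_le _
  | succ t ih =>
    rw [service_succ]
    split_ifs with h
    · exact h.1.2.2
    · exact ih

variable {τ ξ c}

theorem Ready.of_le {t b : ℕ} {i : Fin n} {x : ℕ} (h : τ.Ready ξ c (τ.service ξ c t) t i x)
    (hb : ξ.release i x ≤ b) (hbt : b ≤ t) : τ.Ready ξ c (τ.service ξ c b) b i x :=
  ⟨hb, hbt.trans_lt h.2.1, (τ.service_mono ξ c i x hbt).trans_lt h.2.2⟩

theorem Ready.unique {s : Fin n → ℕ → ℕ} {t : ℕ} {i : Fin n} {x y : ℕ} (hx : τ.Ready ξ c s t i x)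
    (hy : τ.Ready ξ c s t i y) : x = y := by
  by_contra hne
  wlog hxy : x < y generalizing x y
  · exact this hy hx (Ne.symm hne) (by omega)
  have h1 := ξ.sep i x
  have h2 := (ξ.release_strictMono i).monotone (Nat.succ_le_of_lt hxy)
  have h3 := hx.2.1
  have h4 := hy.1
  have h5 := τ.D_le_T i
  simp only [Nat.succ_eq_add_one] at h2
  omega

theorem Ready.exists_executes {s : Fin n → ℕ → ℕ} {t : ℕ} {i : Fin n} {x : ℕ}
    (h : τ.Ready ξ c s t i x) : ∃ j ≤ i, ∃ y, τ.Executes ξ c s t j y := by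
  induction i using WellFoundedLT.induction generalizing x with
  | _ i ih =>
    by_cases hj : ∃ j < i, ∃ y, τ.Ready ξ c s t j y
    · obtain ⟨j, hji, y, hy⟩ := hj
      obtain ⟨l, hl, z, hz⟩ := ih j hji hy
      exact ⟨l, hl.trans hji.le, z, hz⟩
    · push Not at hj
      exact ⟨i, le_rfl, x, h, hj⟩

/-- If in `[a, b)` only jobs from a finite set are executed, one in each slot, and one of them is
unfinished at `b`, then their total execution time exceeds `b - a`. -/
theorem sub_lt_sum_of_executes {J : Finset (Fin n × ℕ)} {a b : ℕ} (hab : a ≤ b)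
    (hexec : ∀ t, a ≤ t → t < b → ∃ p ∈ J, τ.Executes ξ c (τ.service ξ c t) t p.1 p.2)
    (hpend : ∃ p ∈ J, τ.service ξ c b p.1 p.2 < c p) : b - a < ∑ p ∈ J, c p := by
  have key : ∀ d, a + d ≤ b → d ≤ ∑ p ∈ J, τ.service ξ c (a + d) p.1 p.2 := by
    intro d
    induction d with
    | zero => simp
    | succ d ih =>
      intro hd
      obtain ⟨p, hp, hex⟩ := hexec (a + d) (by omega) (by omega)
      refine Nat.succ_le_of_lt ((ih (by omega)).trans_lt
        (Finset.sum_lt_sum (fun q _ => τ.service_mono ξ c q.1 q.2 (by omega)) ⟨p, hp, ?_⟩))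
      rw [← add_assoc, service_succ, if_pos hex]
      exact Nat.lt_succ_self _
  have h := key (b - a) (by omega)
  rw [Nat.add_sub_cancel' hab] at h
  obtain ⟨p, hp, hlt⟩ := hpend
  exact h.trans_lt (Finset.sum_lt_sum (fun q _ => τ.service_le ξ c b q.1 q.2) ⟨p, hp, hlt⟩)

variable (τ ξ c) in
/-- The processor is busy from `a` to the deadline of job `x` of task `k` with that job and jobs of
higher-priority tasks, those of tasks with index at least `m` being released at `a` or later; and
`a` is the release time of that job or of a job of a task with index at least `m`, not too long
before the release of job `x`. -/
structure BusyFrom (k : Fin n) (x m a : ℕ) : Prop where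
  le_release : a ≤ ξ.release k x
  release_le : ξ.release k x ≤ a + ∑ l ∈ Finset.Iio k with m ≤ l.val, τ.D l
  start : a = ξ.release k x ∨ ∃ i < k, ∃ y, ξ.release i y = a ∧
    ξ.release k x < a + ∑ l ∈ Finset.Ico i k, τ.D l
  executes : ∀ t, a ≤ t → t < ξ.release k x + τ.D k →
    ∃ j y, τ.Executes ξ c (τ.service ξ c t) t j y ∧ (j < k ∨ j = k ∧ y = x) ∧
      (m ≤ j.val → a ≤ ξ.release j y)
  -- Unfinished work at the end of each window makes the inequality in `overload` strict.
  pending : ∀ s, a < s → s ≤ ξ.release k x + τ.D k →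
    ∃ j y, (j < k ∨ j = k ∧ y = x) ∧ a ≤ ξ.release j y ∧ ξ.release j y < s ∧
      τ.service ξ c s j y < c (j, y)

theorem busyFrom_release {k : Fin n} {x : ℕ}
    (hfail : τ.service ξ c (ξ.release k x + τ.D k) k x < c (k, x)) :
    BusyFrom τ ξ c k x k (ξ.release k x) where
  le_release := le_rfl
  release_le := Nat.le_add_right _ _
  start := .inl rfl
  executes t ht htD := by
    have hr : τ.Ready ξ c (τ.service ξ c t) t k x :=
      ⟨ht, htD, (τ.service_mono ξ c k x htD.le).trans_lt hfail⟩
    obtain ⟨j, hj, y, hy⟩ := hr.exists_executes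
    rcases hj.lt_or_eq with hj | rfl
    · exact ⟨j, y, hy, .inl hj, fun h => absurd hj (not_lt.2 h)⟩
    · obtain rfl := hy.1.unique hr
      exact ⟨j, y, hy, .inr ⟨rfl, rfl⟩, fun _ => le_rfl⟩
  pending s hs hsD :=
    ⟨k, x, .inr ⟨rfl, rfl⟩, le_rfl, hs, (τ.service_mono ξ c k x hsD).trans_lt hfail⟩

/-- A carry-in job of task `i` is still alive at `a`, so its release is less than `D i` earlier;
while it is pending, only tasks of index at most `i` execute. Without carry-in, `a` stays: an older
job of task `i` executed later would be ready at `a`. -/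
theorem BusyFrom.step {k i : Fin n} {x a : ℕ} (hik : i < k)
    (h : BusyFrom τ ξ c k x (i + 1) a) : ∃ b, BusyFrom τ ξ c k x i b := by
  have hsum : ∑ l ∈ Finset.Iio k with i.val ≤ l.val, τ.D l =
      τ.D i + ∑ l ∈ Finset.Iio k with i.val + 1 ≤ l.val, τ.D l := by
    rw [← Finset.sum_insert (by simp)]
    congr 1
    ext l
    simp only [Finset.mem_filter, Finset.mem_Iio, Finset.mem_insert, Fin.ext_iff, Fin.lt_def]
    have : i.val < k.val := hik
    omega
  have hIco : Finset.Ico i k = {l ∈ Finset.Iio k | i.val ≤ l.val} := by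
    ext l
    simp only [Finset.mem_filter, Finset.mem_Iio, Finset.mem_Ico, Fin.lt_def, Fin.le_def]
    omega
  by_cases hr : ∃ y, τ.Ready ξ c (τ.service ξ c a) a i y ∧ ξ.release i y < a
  · obtain ⟨y, hy, hya⟩ := hr
    have hrel : ξ.release k x < ξ.release i y + ∑ l ∈ Finset.Ico i k, τ.D l := by
      have := h.release_le
      have := hy.2.1
      rw [hIco, hsum]
      omega
    have hready : ∀ t, ξ.release i y ≤ t → t ≤ a → τ.Ready ξ c (τ.service ξ c t) t i y :=
      fun t ht hta => hy.of_le ht hta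
    -- An older job of task `i` executed at `t` would be ready together with job `y` at the release
    -- of `y`.
    have hself : ∀ t z, ξ.release i y ≤ t → τ.Executes ξ c (τ.service ξ c t) t i z →
        ξ.release i y ≤ ξ.release i z := by
      intro t z ht hz
      by_contra! hlt
      have := (hz.1.of_le hlt.le ht).unique (hready _ le_rfl hya.le)
      exact hlt.ne (by rw [this])
    refine ⟨ξ.release i y, hya.le.trans h.le_release, by rw [← hIco]; exact hrel.le,
      .inr ⟨i, hik, y, rfl, hrel⟩, fun t ht htD => ?_, fun s hs hsD => ?_⟩
    · rcases lt_or_ge t a with hta | hta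
      · obtain ⟨j, hj, z, hz⟩ := (hready t ht hta.le).exists_executes
        refine ⟨j, z, hz, .inl (hj.trans_lt hik), fun hij => ?_⟩
        obtain rfl : j = i := le_antisymm hj hij
        exact hself t z ht hz
      · obtain ⟨j, z, hz, hj, hm⟩ := h.executes t hta htD
        refine ⟨j, z, hz, hj, fun hij => ?_⟩
        rcases hij.lt_or_eq with hij | hij
        · exact hya.le.trans (hm hij)
        · obtain rfl : i = j := Fin.ext hij
          exact hself t z ht hz
    · rcases le_or_gt s a with hsa | hsa
      · exact ⟨i, y, .inl hik, le_rfl, hs, (hready s hs.le hsa).2.2⟩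
      · obtain ⟨j, z, hj, h1, h2, h3⟩ := h.pending s hsa hsD
        exact ⟨j, z, hj, hya.le.trans h1, h2, h3⟩
  · push Not at hr
    refine ⟨a, h.le_release, h.release_le.trans (by rw [hsum]; omega), h.start,
      fun t ht htD => ?_, h.pending⟩
    obtain ⟨j, z, hz, hj, hm⟩ := h.executes t ht htD
    refine ⟨j, z, hz, hj, fun hij => ?_⟩
    rcases hij.lt_or_eq with hij | hij
    · exact hm hij
    · obtain rfl : i = j := Fin.ext hij
      by_contra! hlt
      exact hlt.not_ge (hr z (hz.1.of_le hlt.le ht))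

theorem exists_busyFrom_zero {k : Fin n} {x : ℕ}
    (hfail : τ.service ξ c (ξ.release k x + τ.D k) k x < c (k, x)) :
    ∃ a, BusyFrom τ ξ c k x 0 a := by
  refine Nat.decreasingInduction (motive := fun m _ => ∃ a, BusyFrom τ ξ c k x m a)
    (fun m hm ⟨a, ha⟩ => ha.step (i := ⟨m, hm.trans k.isLt⟩) hm)
    ⟨_, busyFrom_release hfail⟩ (Nat.zero_le k.val)

/-- With `m = 0` there is no carry-in at all. By the separation, the jobs of task `j` released in
`[a, a + s)` are among the `⌈s / T j⌉` jobs from `firstIndex` on; of task `k` only job `x` counts.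
-/
theorem BusyFrom.mem_overload {k : Fin n} {x a : ℕ} (h : BusyFrom τ ξ c k x 0 a) :
    c ∈ τ.overload k (Function.update (fun j => ξ.firstIndex j a) k x)
      (ξ.release k x + τ.D k - a) := by
  intro s hs
  have hs := Finset.mem_Icc.1 hs
  have hmem : ∀ j y, (j < k ∨ j = k ∧ y = x) → a ≤ ξ.release j y → ξ.release j y < a + s →
      (j, y) ∈ τ.windowJobs k (Function.update (fun j => ξ.firstIndex j a) k x) s := by
    intro j y hj h1 h2
    rw [mem_windowJobs]
    rcases hj with hj | ⟨rfl, rfl⟩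
    · have hf := ξ.firstIndex_le_iff.2 h1
      refine .inr ⟨hj, by simpa [hj.ne] using hf, ?_⟩
      rw [Function.update_of_ne hj.ne, ← not_le, ceilDiv_le_iff_le_mul (τ.T_pos j), not_le,
        mul_comm]
      have := ξ.release_add_sub_mul_le j hf
      have := ξ.le_release_firstIndex j a
      dsimp only
      omega
    · simp
  have key := sub_lt_sum_of_executes (τ := τ) (ξ := ξ) (c := c) (a := a) (b := a + s)
    (J := τ.windowJobs k (Function.update (fun j => ξ.firstIndex j a) k x) s) (by omega)
    (fun t ht hts => ?_) ?_
  · simpa using key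
  · obtain ⟨j, y, hy, hj, hm⟩ := h.executes t ht (by omega)
    exact ⟨(j, y), hmem j y hj (hm (Nat.zero_le _)) (hy.1.1.trans_lt hts), hy⟩
  · obtain ⟨j, y, hj, h1, h2, h3⟩ := h.pending (a + s) (by omega) (by omega)
    exact ⟨(j, y), hmem j y hj h1 h2, h3⟩

theorem service_lt_of_lt_responseTime {k : Fin n} {x : ℕ}
    (h : (τ.D k : ℕ∞) < τ.responseTime ξ c k x) :
    τ.service ξ c (ξ.release k x + τ.D k) k x < c (k, x) := by
  by_contra! hle
  exact h.not_ge (iInf₂_le (f := fun (d : ℕ) _ => (d : ℕ∞)) (τ.D k) hle)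

end Schedule

/-! ### From busy windows to candidates, and the final bound -/

/-- The release time of the job of task `i` that is the `j`-th latest one released at or before
the release of job `x` of task `k`; for `i = k` only that job itself is considered. -/
noncomputable def startTime (τ : TaskSet n) (ξ : τ.ReleasePattern) (k : Fin n) (x : ℕ)
    (p : Fin n × ℕ) : ℕ :=
  if p.1 = k then ξ.release k x
  else ξ.release p.1 (ξ.firstIndex p.1 (ξ.release k x + 1) - p.2)

/-- The event that the busy period leading to a deadline failure of job `x` of task `k` starts at
the release that the candidate `p` stands for. -/
noncomputable def startEvent (τ : TaskSet n) (ξ : τ.ReleasePattern) (k : Fin n) (x : ℕ)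
    (p : Fin n × ℕ) : Set (ExecPattern n) :=
  -- The guard makes the window at least `(j - 1) * T i + D k` long, whichever release the truncated
  -- subtraction in `startTime` picks. A genuine `j`-th latest release passes it by the separation.
  if τ.startTime ξ k x p + (p.2 - 1) * τ.T p.1 ≤ ξ.release k x then
    τ.overload k (Function.update (fun j => ξ.firstIndex j (τ.startTime ξ k x p)) k x)
      (ξ.release k x + τ.D k - τ.startTime ξ k x p)
  else ∅

theorem exists_candidate_mem_startEvent (τ : TaskSet n) (ξ : τ.ReleasePattern) (k : Fin n) (x : ℕ)
    {c : ExecPattern n} (h : (τ.D k : ℕ∞) < τ.responseTime ξ c k x) :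
    ∃ p ∈ τ.candidates k, c ∈ τ.startEvent ξ k x p := by
  obtain ⟨a, ha⟩ := exists_busyFrom_zero (service_lt_of_lt_responseTime h)
  suffices hp : ∃ p ∈ τ.candidates k, τ.startTime ξ k x p = a ∧
      a + (p.2 - 1) * τ.T p.1 ≤ ξ.release k x by
    obtain ⟨p, hp, hpa, hle⟩ := hp
    refine ⟨p, hp, ?_⟩
    rw [startEvent, hpa, if_pos hle]
    exact ha.mem_overload
  have hmem : ∀ i j, i ≤ k → 1 ≤ j → j ≤ τ.numStarts k i → (i, j) ∈ τ.candidates k := by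
    intro i j hi h1 h2
    simp [candidates, hi, h1, h2]
  rcases ha.start with rfl | ⟨i, hik, y, rfl, hlt⟩
  · exact ⟨(k, 1), hmem k 1 le_rfl le_rfl (by simp [numStarts]), by simp [startTime], by simp⟩
  · have hy : y < ξ.firstIndex i (ξ.release k x + 1) := by
      rw [← not_le, ξ.firstIndex_le_iff]
      have := ha.le_release
      omega
    -- `N` counts the releases of task `i` up to that of job `x`, so job `y` is the `(N - y)`-th
    -- latest.
    set N := ξ.firstIndex i (ξ.release k x + 1)
    have hN : ξ.release i (N - 1) ≤ ξ.release k x := by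
      by_contra! hgt
      have := ξ.firstIndex_le_iff.2 (Nat.succ_le_of_lt hgt)
      simp only [Nat.succ_eq_add_one] at this
      omega
    have hle : ξ.release i y + (N - y - 1) * τ.T i ≤ ξ.release k x := by
      have := ξ.release_add_sub_mul_le i (show y ≤ N - 1 by omega)
      rw [show N - 1 - y = N - y - 1 by omega] at this
      omega
    refine ⟨(i, N - y), hmem i _ hik.le (by omega) ?_, ?_, hle⟩
    · rw [numStarts, if_neg hik.ne]
      -- The strict inequality in `BusyFrom.start` is what keeps the index within `numStarts`.
      have : N - y - 1 < (∑ j ∈ Finset.Ico i k, τ.D j) ⌈/⌉ τ.T i := by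
        rw [← not_le, ceilDiv_le_iff_le_mul (τ.T_pos i), not_le, mul_comm]
        omega
      omega
    · rw [startTime, if_neg hik.ne]
      congr 1
      change N - (N - y) = y
      omega

theorem startEvent_empty_or_eq_overload (τ : TaskSet n) (ξ : τ.ReleasePattern) (k : Fin n) (x : ℕ)
    (p : Fin n × ℕ) : τ.startEvent ξ k x p = ∅ ∨
      ∃ f L, (p.2 - 1) * τ.T p.1 + τ.D k ≤ L ∧ τ.startEvent ξ k x p = τ.overload k f L := by
  rw [startEvent]
  split_ifs with h
  · exact .inr ⟨_, _, by omega, rfl⟩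
  · exact .inl rfl

theorem prob_startEvent_le_busyBound (τ : TaskSet n) (ξ : τ.ReleasePattern) (k : Fin n) (x : ℕ)
    (p : Fin n × ℕ) : τ.prob.real (τ.startEvent ξ k x p) ≤ τ.busyBound k p := by
  rcases τ.startEvent_empty_or_eq_overload ξ k x p with h | ⟨f, L, hL, h⟩ <;> rw [h]
  · rw [measureReal_empty]; exact measureReal_nonneg
  · exact τ.prob_overload_le_busyBound k f hL

theorem prob_startEvent_le_rho (τ : TaskSet n) (ξ : τ.ReleasePattern) (k : Fin n) (x : ℕ)
    (p : Fin n × ℕ) : τ.prob.real (τ.startEvent ξ k x p) ≤ τ.rho k := by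
  rcases τ.startEvent_empty_or_eq_overload ξ k x p with h | ⟨f, L, hL, h⟩ <;> rw [h]
  · rw [measureReal_empty]; exact τ.rho_nonneg k
  · exact τ.prob_overload_le_rho k f ((Nat.le_add_left _ _).trans hL)

theorem isUpperSet_startEvent (τ : TaskSet n) (ξ : τ.ReleasePattern) (k : Fin n) (x : ℕ)
    (p : Fin n × ℕ) : IsUpperSet (τ.startEvent ξ k x p) := by
  rcases τ.startEvent_empty_or_eq_overload ξ k x p with h | ⟨f, L, -, h⟩ <;> rw [h]
  · exact isUpperSet_empty
  · exact τ.isUpperSet_overload k f L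

theorem exists_dependsOn_startEvent (τ : TaskSet n) (ξ : τ.ReleasePattern) (k : Fin n) (x : ℕ)
    (p : Fin n × ℕ) : ∃ J : Finset (Fin n × ℕ),
      DependsOn (· ∈ τ.startEvent ξ k x p) (J : Set (Fin n × ℕ)) := by
  rcases τ.startEvent_empty_or_eq_overload ξ k x p with h | ⟨f, L, -, h⟩ <;> rw [h]
  · exact ⟨∅, fun _ _ _ => by simp⟩
  · exact ⟨_, τ.dependsOn_overload k f L⟩

theorem prob_biUnion_startEvent_le (τ : TaskSet n) (ξ : τ.ReleasePattern) (k : Fin n) (x : ℕ)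
    (s : Finset (Fin n × ℕ)) :
    τ.prob.real (⋃ p ∈ s, τ.startEvent ξ k x p) ≤ 1 - (1 - τ.rho k) ^ s.card := by
  choose J hJ using τ.exists_dependsOn_startEvent ξ k x
  have h1 := prod_one_sub_le_infinitePi_real (fun p : Fin n × ℕ => τ.pwcet p.1)
    (fun p => τ.pwcet_finite p.1) (J := s.biUnion J) s
    (fun p _ => τ.isUpperSet_startEvent ξ k x p)
    (fun p hp => (hJ p).mono (Finset.coe_subset.2 (Finset.subset_biUnion_of_mem J hp)))
  have h2 : (1 - τ.rho k) ^ s.card ≤ ∏ p ∈ s, (1 - τ.prob.real (τ.startEvent ξ k x p)) := by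
    rw [← Finset.prod_const]
    exact Finset.prod_le_prod (fun _ _ => sub_nonneg.2 (τ.rho_le_one k))
      fun p _ => sub_le_sub_left (τ.prob_startEvent_le_rho ξ k x p) 1
  have h3 := h2.trans h1
  rw [← prob] at h3
  linarith

theorem dfp_le (τ : TaskSet n) (ξ : τ.ReleasePattern) (k : Fin n) (x : ℕ) :
    τ.dfp ξ k x ≤ ∑ p ∈ τ.B1 k, τ.busyBound k p + (1 - (1 - τ.rho k) ^ (τ.B2 k).card) := by
  have hsub : {c | (τ.D k : ℕ∞) < τ.responseTime ξ c k x} ⊆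
      (⋃ p ∈ τ.B1 k, τ.startEvent ξ k x p) ∪ ⋃ p ∈ τ.B2 k, τ.startEvent ξ k x p := by
    intro c hc
    obtain ⟨p, hp, hcp⟩ := τ.exists_candidate_mem_startEvent ξ k x hc
    rcases lt_or_ge (τ.busyBound k p) (τ.rho k) with h | h
    · exact .inl (Set.mem_biUnion (show p ∈ τ.B1 k by simp [B1, hp, h]) hcp)
    · exact .inr (Set.mem_biUnion (show p ∈ τ.B2 k by simp [B2, hp, h]) hcp)
  calc τ.dfp ξ k x
      ≤ τ.prob.real (⋃ p ∈ τ.B1 k, τ.startEvent ξ k x p) +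
          τ.prob.real (⋃ p ∈ τ.B2 k, τ.startEvent ξ k x p) :=
        (measureReal_mono hsub).trans (measureReal_union_le _ _)
    _ ≤ _ := add_le_add
        ((measureReal_biUnion_finset_le _ _).trans
          (Finset.sum_le_sum fun p _ => τ.prob_startEvent_le_busyBound ξ k x p))
        (τ.prob_biUnion_startEvent_le ξ k x _)

end TaskSet

theorem mainTheorem1 {n : ℕ} (τ : TaskSet n) (k : Fin n) :
    τ.wcdfp k ≤
      ∑ p ∈ τ.B1 k, τ.prob.real
          {c | (((p.2 - 1) * τ.T p.1 + τ.D k : ℕ) : ℕ∞) ≤ τ.busyLength k c}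
        + (1 - (1 - τ.rho k) ^ (τ.B2 k).card) := by
  have hnonneg : 0 ≤ ∑ p ∈ τ.B1 k, τ.busyBound k p + (1 - (1 - τ.rho k) ^ (τ.B2 k).card) :=
    add_nonneg (Finset.sum_nonneg fun _ _ => MeasureTheory.measureReal_nonneg)
      (sub_nonneg.2 (pow_le_one₀ (sub_nonneg.2 (τ.rho_le_one k))
        (sub_le_self _ (τ.rho_nonneg k))))
  -- Nonnegativity of the bound is needed because a real supremum over an empty family is `0`.
  exact Real.iSup_le (fun ξ => Real.iSup_le (fun x => τ.dfp_le ξ k x) hnonneg) hnonneg
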